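/- Let $m>0$ and $c\in\mathbb{R}$, let $b:\mathbb{R}^3\to\mathbb{R}^3$ be differentiable with $\nabla\cdot b=0$, and put $\omega(q)=\tfrac{c}{m}\,b(q)$, $$\Omega(q)=\begin{bmatrix}0&\omega_3(q)&-\omega_2(q)\\-\omega_3(q)&0&\omega_1(q)\\ \omega_2(q)&-\omega_1(q)&0\end{bmatrix},\qquad B(y)=\begin{bmatrix}0&I\\-I&m\,\Omega(q)\end{bmatrix}\in\mathbb{R}^{6\times 6},\qquad y=\begin{bmatrix}q\\p\end{bmatrix}\in\mathbb{R}^3\times\mathbb{R}^3.$$ Let $H:\mathbb{R}^6\to\mathbb{R}$ be a differentiable Hamiltonian such that the vector field $X(y)=B(y)\nabla H(y)$ is continuously differentiable. (This covers $H(q,p)=\tfrac1{2m}\|p\|^2+c\,\Phi(q)$ with $b\in C^1$ and $\Phi\in C^2$.) Then $y'=X(y)$ is a Poisson system, i.e. $B$ is skew-symmetric and satisfies the Jacobi identity $$\sum_{\ell=1}^{6}\Big(\frac{\partial B_{ij}}{\partial y_\ell}B_{\ell k}+\frac{\partial B_{jk}}{\partial y_\ell}B_{\ell i}+\frac{\partial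 B_{ki}}{\partial y_\ell}B_{\ell j}\Big)=0\quad\text{for all } i,j,k,$$ and its exact flow is volume preserving: for every $t\in\mathbb{R}$, let $D_t$ be the set of all $y_0\in\mathbb{R}^6$ for which the initial value problem $y'=X(y)$, $y(0)=y_0$ has a solution on the closed interval between $0$ and $t$. Then $D_t$ is open, the flow map $\varphi_t:D_t\to\mathbb{R}^6$, $y(0)\mapsto y(t)$, is well defined and differentiable, and $$\det\frac{\partial\varphi_t(y)}{\partial y}=1\qquad\text{for all } y\in D_t .$$ -/

import Mathlib

namespace PoissonFlow

/-- The partial derivative of `f : ℝ^ι → ℝ` in the `i`-th coordinate direction. -/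
noncomputable def pderiv {ι : Type*} [Fintype ι] [DecidableEq ι]
    (i : ι) (f : (ι → ℝ) → ℝ) (y : ι → ℝ) : ℝ :=
  fderiv ℝ f y (Pi.single i 1)

/-- The gradient, as the vector of all partial derivatives. -/
noncomputable def grad {ι : Type*} [Fintype ι] [DecidableEq ι]
    (f : (ι → ℝ) → ℝ) (y : ι → ℝ) : ι → ℝ :=
  fun i => pderiv i f y

/-- The divergence of a vector field. -/
noncomputable def divergence {ι : Type*} [Fintype ι] [DecidableEq ι]
    (v : (ι → ℝ) → (ι → ℝ)) (y : ι → ℝ) : ℝ :=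
  ∑ i, pderiv i (fun z => v z i) y

/-- A (differentiable) matrix field `B` is a Poisson tensor if it is skew-symmetric and
satisfies the Jacobi identity. -/
structure IsPoissonTensor {ι : Type*} [Fintype ι] [DecidableEq ι]
    (B : (ι → ℝ) → Matrix ι ι ℝ) : Prop where
  differentiable : ∀ i j, Differentiable ℝ (fun y => B y i j)
  skew : ∀ y, (B y).transpose = -B y
  jacobi : ∀ y i j k,
    ∑ l, (pderiv l (fun z => B z i j) y * B y l k
        + pderiv l (fun z => B z j k) y * B y l i
        + pderiv l (fun z => B z k i) y * B y l j) = 0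

/-- The right-hand side `B(y) ∇H(y)` of the system `y' = B(y) ∇H(y)`. -/
noncomputable def vectorField {ι : Type*} [Fintype ι] [DecidableEq ι]
    (B : (ι → ℝ) → Matrix ι ι ℝ) (H : (ι → ℝ) → ℝ) (y : ι → ℝ) : ι → ℝ :=
  (B y).mulVec (grad H y)

/-- The matrix `Ω` with `Ω p = p × ω`. -/
def crossMatrix (ω : Fin 3 → ℝ) : Matrix (Fin 3) (Fin 3) ℝ :=
  !![0, ω 2, -ω 1; -ω 2, 0, ω 0; ω 1, -ω 0, 0]

/-- Phase space `ℝ⁶ = ℝ³ × ℝ³`: the coordinates `Sum.inl i` are the positions `q_i`, the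
coordinates `Sum.inr i` are the momenta `p_i`. -/
abbrev Phase : Type := Fin 3 ⊕ Fin 3 → ℝ

/-- The structure matrix `B(y) = [[0, I], [-I, m Ω(q)]]` of a particle of mass `m` and charge `c`
in the magnetic field `b`, where `Ω(q) p = p × ω(q)` and `ω(q) = (c / m) b(q)`. -/
noncomputable def structureMatrix (m c : ℝ) (b : (Fin 3 → ℝ) → (Fin 3 → ℝ)) (y : Phase) :
    Matrix (Fin 3 ⊕ Fin 3) (Fin 3 ⊕ Fin 3) ℝ :=
  Matrix.fromBlocks 0 1 (-1) (m • crossMatrix ((c / m) • b (fun i => y (Sum.inl i))))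

/-- The domain of the time-`t` map: the initial values `y₀` for which `y' = X(y)`, `y(0) = y₀`
has a solution on the closed interval between `0` and `t` (`t` may be negative). -/
def flowDomain {E : Type*} [NormedAddCommGroup E] [NormedSpace ℝ E]
    (X : E → E) (t : ℝ) : Set E :=
  {y₀ | ∃ γ : ℝ → E, γ 0 = y₀ ∧ IsIntegralCurveOn γ (fun _ => X) (Set.uIcc 0 t)}

open Classical in
/-- The exact flow `φ_t : y(0) ↦ y(t)` of `y' = X(y)` on `flowDomain X t`
(the value outside of that set is irrelevant). -/
noncomputable def exactFlow {E : Type*} [NormedAddCommGroup E] [NormedSpace ℝ E]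
    (X : E → E) (t : ℝ) (y₀ : E) : E :=
  if h : y₀ ∈ flowDomain X t then h.choose t else y₀

/-- The Jacobian matrix `∂F_i / ∂y_j`. -/
noncomputable def jacobian {ι : Type*} [Fintype ι] [DecidableEq ι]
    (F : (ι → ℝ) → (ι → ℝ)) (y : ι → ℝ) : Matrix ι ι ℝ :=
  Matrix.of fun i j => pderiv j (fun z => F z i) y

end PoissonFlow

/-!
# The charged-particle system is Poisson and its flow preserves volume

The flow of a divergence-free `C¹` field preserves volume, so two facts about `B` and `X = B ∇H`
suffice: the Jacobi identity and `∇ · X = 0`.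

*The Poisson tensor.* Only the block `m Ω(q)` of `B` varies, and the Jacobi identity reduces to
`∇ · b = 0` (`isPoissonTensor_structureMatrix`).

*The divergence.* The components of `X` are `∂H/∂p` and `-∂H/∂q + m Ω ∂H/∂p`. Since `X` and `Ω` are
differentiable, so are all partial derivatives of `H`; hence `H` is twice differentiable and its
Hessian is symmetric (`pderiv_grad_comm`). Pairing it with the skew matrix `B` gives zero, and the
derivative of `B` does not contribute because `Ω` does not depend on `p`
(`divergence_vectorField_eq_zero`).

*The flow.* A solution on `[0, T]` lies in a ball, and cutting `X` off outside a larger one gives a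
bounded, globally Lipschitz field with global solutions. By Grönwall's inequality nearby solutions
remain where nothing was changed, so the domain of the flow is open, and the difference of two
solutions agrees to first order with the solution of the variational equation `M' = DX(γ) M`, so the
flow is differentiable with derivative `M(T)` (`exists_flow_hasFDerivAt`). Liouville's formula
`(det M)' = tr DX(γ) * det M` (`hasDerivWithinAt_det_of_linear`) and `tr DX = ∇ · X = 0` give
`det M(T) = 1`. Negative times follow by replacing `X` with `-X`.
-/

namespace PoissonFlow

open Set Metric Filter Topology
open scoped NNReal

/-! ### Ordinary differential equations with a `C¹` right-hand side -/

section ODE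

variable {E : Type*} [NormedAddCommGroup E] [NormedSpace ℝ E]

/-- A bounded field that is Lipschitz in space has solutions on all of `[0, T]`. The time of
existence in the Picard-Lindelöf theorem is limited only by the need to stay in a ball, and a ball
of radius `C * T` is large enough. -/
theorem exists_solution_of_lipschitz_of_bounded [CompleteSpace E] {T : ℝ} (hT : 0 ≤ T)
    {f : ℝ → E → E} {K : ℝ≥0} {C : ℝ} (hlip : ∀ t ∈ Icc 0 T, LipschitzWith K (f t))
    (hcont : ∀ x, ContinuousOn (fun t => f t x) (Icc 0 T))
    (hbound : ∀ t ∈ Icc 0 T, ∀ x, ‖f t x‖ ≤ C) (x₀ : E) :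
    ∃ γ : ℝ → E, γ 0 = x₀ ∧ IsIntegralCurveOn γ f (Icc 0 T) := by
  have hpl : IsPicardLindelof f (⟨0, le_rfl, hT⟩ : Icc 0 T) x₀
      (C.toNNReal * T.toNNReal) 0 C.toNNReal K :=
    { lipschitzOnWith := fun t ht => (hlip t ht).lipschitzOnWith
      continuousOn := fun x _ => hcont x
      norm_le := fun t ht x _ => (hbound t ht x).trans (Real.le_coe_toNNReal C)
      mul_max_le := by simp [hT] }
  exact hpl.exists_eq_forall_mem_Icc_hasDerivWithinAt₀

/-- Multiplying a `C¹` field by a bump function makes it compactly supported, hence bounded and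
globally Lipschitz, without changing it on a given ball. -/
theorem exists_compactSupport_eqOn_ball [FiniteDimensional ℝ E] {X : E → E}
    (hX : ContDiff ℝ 1 X) {R : ℝ} (hR : 0 < R) :
    ∃ Y : E → E, ContDiff ℝ 1 Y ∧ HasCompactSupport Y ∧ EqOn Y X (ball 0 R) ∧
      ∀ x, ‖Y x‖ ≤ ‖X x‖ := by
  let χ : ContDiffBump (0 : E) := ⟨R, R + 1, hR, by linarith⟩
  refine ⟨fun x => χ x • X x, χ.contDiff.smul hX, χ.hasCompactSupport.smul_right, ?_, ?_⟩
  · intro x hx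
    simp [χ.one_of_mem_closedBall (ball_subset_closedBall hx)]
  · intro x
    rw [norm_smul, Real.norm_of_nonneg χ.nonneg]
    exact mul_le_of_le_one_left (norm_nonneg _) χ.le_one

theorem _root_.IsIntegralCurveOn.hasDerivWithinAt_Ici {f : ℝ → E → E} {γ : ℝ → E} {T : ℝ}
    (hγ : IsIntegralCurveOn γ f (Icc 0 T)) {t : ℝ} (ht : t ∈ Ico 0 T) :
    HasDerivWithinAt γ (f t (γ t)) (Ici t) t :=
  (hγ t (Ico_subset_Icc_self ht)).mono_of_mem_nhdsWithin (Icc_mem_nhdsGE_of_mem ht)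

/-- Linear equations have solutions on the whole interval. The identity is cut off outside a large
ball, which makes the right-hand side bounded; by Grönwall's inequality the solution of the modified
equation never reaches the region where the modification is felt. -/
theorem exists_solution_linear [FiniteDimensional ℝ E] {T : ℝ} (hT : 0 ≤ T)
    {A : ℝ → E →L[ℝ] E} (hA : ContinuousOn A (Icc 0 T)) (x₀ : E) :
    ∃ γ : ℝ → E, γ 0 = x₀ ∧ IsIntegralCurveOn γ (fun t x => A t x) (Icc 0 T) := by
  have := FiniteDimensional.complete ℝ E
  obtain ⟨C, hC⟩ := isCompact_Icc.exists_bound_of_continuousOn hA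
  have hC0 : 0 ≤ C := (norm_nonneg _).trans (hC 0 ⟨le_rfl, hT⟩)
  -- A solution of the linear equation cannot leave the ball of this radius before time `T`.
  set R := ‖x₀‖ * Real.exp (C * T) + 1 with hR
  have hR0 : 0 < R := by positivity
  obtain ⟨g, hg, hgs, hgid, hgle⟩ := exists_compactSupport_eqOn_ball (E := E) contDiff_id hR0
  obtain ⟨K, hK⟩ := ContDiff.lipschitzWith_of_hasCompactSupport hgs hg one_ne_zero
  obtain ⟨D, hD⟩ := hgs.exists_bound_of_continuous hg.continuous
  have hD0 : 0 ≤ D := (norm_nonneg _).trans (hD 0)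
  obtain ⟨γ, hγ0, hγ⟩ := exists_solution_of_lipschitz_of_bounded (f := fun t x => A t (g x))
    (K := C.toNNReal * K) (C := C * D) hT
    (fun t ht => by
      refine LipschitzWith.comp ?_ hK
      refine (A t).lipschitz.weaken ?_
      rw [← NNReal.coe_le_coe, coe_nnnorm]
      exact (hC t ht).trans (Real.le_coe_toNNReal C))
    (fun x => hA.clm_apply continuousOn_const)
    (fun t ht x => ((A t).le_opNorm _).trans
      (mul_le_mul (hC t ht) (hD x) (norm_nonneg _) hC0)) x₀
  refine ⟨γ, hγ0, fun t ht => ?_⟩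
  have hbd := norm_le_gronwallBound_of_norm_deriv_right_le (f := γ) (δ := ‖x₀‖) (K := C) (ε := 0)
    hγ.continuousOn (fun s hs => hγ.hasDerivWithinAt_Ici hs) (by rw [hγ0])
    (fun s hs => by
      rw [add_zero]
      exact ((A s).le_opNorm _).trans
        (mul_le_mul (hC s (Ico_subset_Icc_self hs)) (hgle _) (norm_nonneg _) hC0)) t ht
  have hmem : γ t ∈ ball (0 : E) R := by
    rw [mem_ball_zero_iff, hR]
    refine lt_of_le_of_lt hbd ?_
    rw [gronwallBound_ε0, sub_zero]
    have : Real.exp (C * t) ≤ Real.exp (C * T) := by gcongr; exact ht.2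
    nlinarith [norm_nonneg x₀]
  have h := hγ t ht
  simp only [hgid hmem, id] at h
  exact h

theorem _root_.IsIntegralCurveOn.exists_norm_lt {f : ℝ → E → E} {γ : ℝ → E} {T : ℝ}
    (hγ : IsIntegralCurveOn γ f (Icc 0 T)) : ∃ R : ℝ, 0 < R ∧ ∀ t ∈ Icc 0 T, ‖γ t‖ < R := by
  obtain ⟨C, hC⟩ := isCompact_Icc.exists_bound_of_continuousOn hγ.continuousOn
  exact ⟨|C| + 1, by positivity, fun t ht => by linarith [hC t ht, le_abs_self C]⟩

/-- Forward uniqueness for a `C¹` field. Such a field need not be globally Lipschitz, but the two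
curves stay in a common ball, outside of which the field may be cut off. -/
theorem eqOn_Icc_of_isIntegralCurveOn [FiniteDimensional ℝ E] {X : E → E}
    (hX : ContDiff ℝ 1 X) {T : ℝ} {γ η : ℝ → E}
    (hγ : IsIntegralCurveOn γ (fun _ => X) (Icc 0 T))
    (hη : IsIntegralCurveOn η (fun _ => X) (Icc 0 T)) (h0 : γ 0 = η 0) :
    EqOn γ η (Icc 0 T) := by
  obtain ⟨R, hR, hγR⟩ := hγ.exists_norm_lt
  obtain ⟨S, hS, hηS⟩ := hη.exists_norm_lt
  obtain ⟨Y, hY, hYs, hYX, -⟩ := exists_compactSupport_eqOn_ball hX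
    (lt_max_of_lt_left hR : 0 < max R S)
  obtain ⟨K, hK⟩ := ContDiff.lipschitzWith_of_hasCompactSupport hYs hY one_ne_zero
  refine ODE_solution_unique (v := fun _ => Y) (fun _ => hK) hγ.continuousOn (fun t ht => ?_)
    hη.continuousOn (fun t ht => ?_) h0
  · rw [hYX (mem_ball_zero_iff.2 (lt_max_of_lt_left (hγR t (Ico_subset_Icc_self ht))))]
    exact hγ.hasDerivWithinAt_Ici ht
  · rw [hYX (mem_ball_zero_iff.2 (lt_max_of_lt_right (hηS t (Ico_subset_Icc_self ht))))]
    exact hη.hasDerivWithinAt_Ici ht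

/-- The first-order Taylor expansion of a compactly supported `C¹` map is uniform in the base
point, because the derivative is uniformly continuous. -/
theorem uniform_taylor [FiniteDimensional ℝ E] {Y : E → E} (hY : ContDiff ℝ 1 Y)
    (hYs : HasCompactSupport Y) {ε : ℝ} (hε : 0 < ε) :
    ∃ δ > 0, ∀ x z : E, ‖z - x‖ < δ → ‖Y z - Y x - fderiv ℝ Y x (z - x)‖ ≤ ε * ‖z - x‖ := by
  have huc : UniformContinuous (fderiv ℝ Y) :=
    (hYs.fderiv (𝕜 := ℝ)).uniformContinuous_of_continuous (hY.continuous_fderiv one_ne_zero)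
  obtain ⟨δ, hδ, h⟩ := Metric.uniformContinuous_iff.1 huc ε hε
  refine ⟨δ, hδ, fun x z hz => ?_⟩
  refine (convex_ball x δ).norm_image_sub_le_of_norm_hasFDerivWithin_le' (f' := fderiv ℝ Y)
    (fun y _ => ((hY.differentiable one_ne_zero) y).hasFDerivAt.hasFDerivWithinAt)
    (fun y hy => ?_) (mem_ball_self hδ) (by rwa [mem_ball, dist_eq_norm])
  rw [← dist_eq_norm]
  exact (h (mem_ball.1 hy)).le

/-- The difference `η - γ` of two integral curves solves the variational equation along `γ` up to
the Taylor remainder of `Y`, which is at most `ε * ‖η - γ‖`. Grönwall's inequality, used once for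
`η - γ` and once for `η - γ - u`, bounds its distance from the exact solution `u`. -/
theorem norm_flow_sub_sub_le {Y : E → E} {K : ℝ≥0} (hK : LipschitzWith K Y) {T : ℝ} (hT : 0 ≤ T)
    {γ η u : ℝ → E} (hγ : IsIntegralCurveOn γ (fun _ => Y) (Icc 0 T))
    (hη : IsIntegralCurveOn η (fun _ => Y) (Icc 0 T))
    (hu : IsIntegralCurveOn u (fun t x => fderiv ℝ Y (γ t) x) (Icc 0 T))
    (hu0 : u 0 = η 0 - γ 0) {ε δ : ℝ} (hε : 0 ≤ ε)
    (htaylor : ∀ x z : E, ‖z - x‖ < δ → ‖Y z - Y x - fderiv ℝ Y x (z - x)‖ ≤ ε * ‖z - x‖)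
    (hδ : ‖η 0 - γ 0‖ * Real.exp (K * T) < δ) :
    ‖η T - γ T - u T‖ ≤ gronwallBound 0 K (ε * (‖η 0 - γ 0‖ * Real.exp (K * T))) T := by
  have hdist : ∀ t ∈ Icc 0 T, ‖η t - γ t‖ ≤ ‖η 0 - γ 0‖ * Real.exp (K * T) := by
    intro t ht
    have h := dist_le_of_trajectories_ODE (v := fun _ => Y) (fun _ => hK) hη.continuousOn
      (fun t ht => hη.hasDerivWithinAt_Ici ht) hγ.continuousOn
      (fun t ht => hγ.hasDerivWithinAt_Ici ht) le_rfl t ht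
    rw [dist_eq_norm, dist_eq_norm, sub_zero] at h
    refine h.trans ?_
    gcongr
    exact ht.2
  have hfd : ∀ x, ‖fderiv ℝ Y x‖ ≤ K := fun x => norm_fderiv_le_of_lipschitz ℝ hK
  have h := norm_le_gronwallBound_of_norm_deriv_right_le (f := fun t => η t - γ t - u t)
    (f' := fun t => Y (η t) - Y (γ t) - fderiv ℝ Y (γ t) (u t)) (δ := 0) (K := K)
    (ε := ε * (‖η 0 - γ 0‖ * Real.exp (K * T)))
    ((hη.continuousOn.sub hγ.continuousOn).sub hu.continuousOn)
    (fun t ht => ((hη.hasDerivWithinAt_Ici ht).sub (hγ.hasDerivWithinAt_Ici ht)).sub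
      (hu.hasDerivWithinAt_Ici ht)) (by simp [hu0])
    (fun t ht => ?_) T ⟨hT, le_rfl⟩
  · simpa using h
  · have htc := Ico_subset_Icc_self ht
    have h1 := htaylor (γ t) (η t) ((hdist t htc).trans_lt hδ)
    have h2 : ‖fderiv ℝ Y (γ t) (η t - γ t - u t)‖ ≤ K * ‖η t - γ t - u t‖ :=
      ((fderiv ℝ Y (γ t)).le_opNorm _).trans
        (mul_le_mul_of_nonneg_right (hfd _) (norm_nonneg _))
    calc ‖Y (η t) - Y (γ t) - fderiv ℝ Y (γ t) (u t)‖
        = ‖fderiv ℝ Y (γ t) (η t - γ t - u t)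
            + (Y (η t) - Y (γ t) - fderiv ℝ Y (γ t) (η t - γ t))‖ := by
          congr 1; simp only [map_sub]; abel
      _ ≤ K * ‖η t - γ t - u t‖ + ε * ‖η t - γ t‖ := (norm_add_le _ _).trans (add_le_add h2 h1)
      _ ≤ _ := by gcongr; exact hdist t htc

/-- Differentiable dependence on initial values for a `C¹` field: near the initial value of an
integral curve `γ` on `[0, T]` all integral curves exist on `[0, T]`, and the derivative of the
time-`T` map at `γ 0` is the value at `T` of the solution `M` of the variational equation
`M' = DX(γ) M`, `M(0) = 1`. -/
theorem exists_flow_hasFDerivAt [FiniteDimensional ℝ E] {X : E → E} (hX : ContDiff ℝ 1 X)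
    {T : ℝ} (hT : 0 ≤ T) {γ : ℝ → E} (hγ : IsIntegralCurveOn γ (fun _ => X) (Icc 0 T)) :
    ∃ (φ : E → ℝ → E) (M : ℝ → E →L[ℝ] E),
      (∀ᶠ x in 𝓝 (γ 0), φ x 0 = x ∧ IsIntegralCurveOn (φ x) (fun _ => X) (Icc 0 T)) ∧
      M 0 = ContinuousLinearMap.id ℝ E ∧
      IsIntegralCurveOn M (fun t A => (fderiv ℝ X (γ t)).comp A) (Icc 0 T) ∧
      HasFDerivAt (fun x => φ x T) (M T) (γ 0) := by
  have := FiniteDimensional.complete ℝ E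
  obtain ⟨R, hR, hγR⟩ := hγ.exists_norm_lt
  obtain ⟨Y, hY, hYs, hYX, -⟩ :=
    exists_compactSupport_eqOn_ball hX (by linarith : 0 < R + 1)
  obtain ⟨K, hK⟩ := ContDiff.lipschitzWith_of_hasCompactSupport hYs hY one_ne_zero
  obtain ⟨C, hC⟩ := hYs.exists_bound_of_continuous hY.continuous
  have hγball : ∀ t ∈ Icc 0 T, γ t ∈ ball (0 : E) (R + 1) := fun t ht =>
    mem_ball_zero_iff.2 (by linarith [hγR t ht])
  have hγY : IsIntegralCurveOn γ (fun _ => Y) (Icc 0 T) := fun t ht =>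
    (hγ t ht).congr_deriv (hYX (hγball t ht)).symm
  have hfd : ∀ t ∈ Icc 0 T, fderiv ℝ Y (γ t) = fderiv ℝ X (γ t) := fun t ht =>
    (hYX.eventuallyEq_of_mem (isOpen_ball.mem_nhds (hγball t ht))).fderiv_eq
  choose φ hφ0 hφ using fun x => exists_solution_of_lipschitz_of_bounded hT
    (f := fun _ => Y) (fun _ _ => hK) (fun _ => continuousOn_const) (fun _ _ => hC) x
  have hAc : ContinuousOn (fun t => ContinuousLinearMap.compL ℝ E E E (fderiv ℝ Y (γ t)))
      (Icc 0 T) :=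
    (ContinuousLinearMap.compL ℝ E E E).continuous.comp_continuousOn
      ((hY.continuous_fderiv one_ne_zero).comp_continuousOn hγ.continuousOn)
  obtain ⟨M, hM0, hM⟩ := exists_solution_linear hT hAc (ContinuousLinearMap.id ℝ E)
  simp only [ContinuousLinearMap.compL_apply] at hM
  set κ := Real.exp (K * T) with hκ
  have hκ0 : 0 < κ := Real.exp_pos _
  refine ⟨φ, M, ?_, hM0, fun t ht => by simpa only [hfd t ht] using hM t ht, ?_⟩
  -- Curves that start within `κ⁻¹` of `γ 0` stay within distance one of `γ`, hence in the ball
  -- where `Y = X`.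
  · filter_upwards [ball_mem_nhds (γ 0) (inv_pos.2 hκ0)] with x hx
    refine ⟨hφ0 x, fun t ht => ?_⟩
    have hd := dist_le_of_trajectories_ODE (v := fun _ => Y) (fun _ => hK) (hφ x).continuousOn
      (fun t ht => (hφ x).hasDerivWithinAt_Ici ht) hγY.continuousOn
      (fun t ht => hγY.hasDerivWithinAt_Ici ht) le_rfl t ht
    have hmem : φ x t ∈ ball (0 : E) (R + 1) := by
      have h1 : dist (φ x t) (γ t) < 1 := by
        refine hd.trans_lt ?_
        rw [hφ0, sub_zero]
        calc dist x (γ 0) * Real.exp (K * t) ≤ dist x (γ 0) * κ := by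
              rw [hκ]; gcongr; exact ht.2
          _ < κ⁻¹ * κ := by gcongr; exact hx
          _ = 1 := inv_mul_cancel₀ hκ0.ne'
      rw [mem_ball_zero_iff]
      have h2 := norm_le_norm_add_norm_sub' (φ x t) (γ t)
      rw [dist_eq_norm] at h1
      linarith [hγR t ht]
    exact (hφ x t ht).congr_deriv (hYX hmem)
  · have hγφ : φ (γ 0) T = γ T :=
      eqOn_Icc_of_isIntegralCurveOn hY (hφ (γ 0)) hγY (hφ0 _) ⟨hT, le_rfl⟩
    rw [hasFDerivAt_iff_isLittleO_nhds_zero, Asymptotics.isLittleO_iff]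
    intro c hc
    -- The Grönwall bound is linear in its inhomogeneity; `G` is its value at inhomogeneity one.
    set G := gronwallBound 0 K 1 T with hG
    have hGlin : ∀ a, gronwallBound 0 K a T = a * G := by
      intro a
      rw [hG]
      unfold gronwallBound
      split_ifs <;> ring
    have hG0 : 0 ≤ G := by
      have := gronwallBound_mono (le_refl (0 : ℝ)) zero_le_one K.2 hT
      rwa [gronwallBound_x0] at this
    -- The final bound is `ε * κ * G * ‖h‖`; adding one keeps the denominator positive when `T = 0`.
    obtain ⟨δ, hδ, htay⟩ := uniform_taylor hY hYs (ε := c / (κ * G + 1)) (by positivity)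
    filter_upwards [ball_mem_nhds (0 : E) (by positivity : 0 < δ / κ)] with h hh
    rw [mem_ball_zero_iff, lt_div_iff₀ hκ0] at hh
    have hu : IsIntegralCurveOn (fun t => M t h) (fun t x => fderiv ℝ Y (γ t) x) (Icc 0 T) :=
      fun t ht => by
        have := (hM t ht).clm_apply (hasDerivWithinAt_const t (Icc 0 T) h)
        simpa using this
    have key := norm_flow_sub_sub_le hK hT hγY (hφ (γ 0 + h)) hu (by simp [hM0, hφ0])
      (by positivity) htay (by simpa [hφ0] using hh)
    rw [hφ0, add_sub_cancel_left, hGlin] at key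
    simp only [hγφ]
    refine key.trans ?_
    have : c / (κ * G + 1) * (‖h‖ * κ) * G = (c * ‖h‖) * (κ * G / (κ * G + 1)) := by ring
    rw [this]
    refine mul_le_of_le_one_right (by positivity) ?_
    rw [div_le_one (by positivity)]
    linarith

end ODE

/-! ### Liouville's formula -/

section Liouville

variable {ι : Type*} [Fintype ι] [DecidableEq ι]

/-- Liouville's formula: if `D' = A D` at time `t`, then `(det D)' = tr A * det D`. The determinant
is multilinear in the rows, and replacing row `i` of `D` by row `i` of `A D` multiplies the
determinant by `A i i`. -/
theorem hasDerivWithinAt_det_of_linear {D : ℝ → Matrix ι ι ℝ} {A : Matrix ι ι ℝ} {s : Set ℝ}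
    {t : ℝ} (hD : ∀ i j, HasDerivWithinAt (fun t => D t i j) ((A * D t) i j) s t) :
    HasDerivWithinAt (fun t => (D t).det) (A.trace * (D t).det) s t := by
  let F : ContinuousMultilinearMap ℝ (fun _ : ι => ι → ℝ) ℝ :=
    { toMultilinearMap := (Matrix.detRowAlternating (n := ι) (R := ℝ)).toMultilinearMap
      cont := Continuous.matrix_det continuous_id }
  have hD' : HasDerivWithinAt (fun t => (D t : ι → ι → ℝ)) (A * D t : ι → ι → ℝ) s t :=
    hasDerivWithinAt_pi.2 fun i => hasDerivWithinAt_pi.2 fun j => hD i j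
  have h := (F.hasFDerivAt (D t)).comp_hasDerivWithinAt t hD'
  refine h.congr_deriv ((ContinuousMultilinearMap.linearDeriv_apply F _ _).trans ?_)
  rw [Matrix.trace, Finset.sum_mul]
  refine Finset.sum_congr rfl fun i _ => ?_
  have hrow : (A * D t) i = ∑ k, A i k • D t k := by
    ext j
    simp [Matrix.mul_apply, Finset.sum_apply]
  have := Matrix.det_updateRow_sum (D t) i (A i)
  rw [← hrow] at this
  exact this

theorem jacobian_eq_toMatrix' {F : (ι → ℝ) → (ι → ℝ)} {L : (ι → ℝ) →L[ℝ] (ι → ℝ)} {y : ι → ℝ}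
    (hF : HasFDerivAt F L y) : jacobian F y = LinearMap.toMatrix' (L : (ι → ℝ) →ₗ[ℝ] (ι → ℝ)) := by
  ext i j
  simp only [jacobian, Matrix.of_apply, pderiv, LinearMap.toMatrix'_apply]
  rw [(hasFDerivAt_pi'.1 hF i).fderiv]
  simp

theorem trace_jacobian (X : (ι → ℝ) → (ι → ℝ)) (y : ι → ℝ) :
    (jacobian X y).trace = divergence X y := rfl

/-- Along a divergence-free field the solution of the variational equation has determinant one. -/
theorem det_eq_one_of_divergence_eq_zero {X : (ι → ℝ) → (ι → ℝ)} (hX : Differentiable ℝ X)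
    (hdiv : ∀ y, divergence X y = 0) {T : ℝ} (hT : 0 ≤ T) {γ : ℝ → ι → ℝ}
    {M : ℝ → (ι → ℝ) →L[ℝ] (ι → ℝ)} (hM0 : M 0 = ContinuousLinearMap.id ℝ (ι → ℝ))
    (hM : IsIntegralCurveOn M (fun t A => (fderiv ℝ X (γ t)).comp A) (Icc 0 T)) :
    (LinearMap.toMatrix' (M T : (ι → ℝ) →ₗ[ℝ] (ι → ℝ))).det = 1 := by
  set D : ℝ → Matrix ι ι ℝ := fun t => LinearMap.toMatrix' (M t : (ι → ℝ) →ₗ[ℝ] (ι → ℝ)) with hD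
  have hder : ∀ t ∈ Icc 0 T, HasDerivWithinAt (fun t => (D t).det) 0 (Icc 0 T) t := by
    intro t ht
    have h := hasDerivWithinAt_det_of_linear (D := D) (A := jacobian X (γ t)) (s := Icc 0 T)
      (t := t)
      (fun i j => by
        have h1 := hasDerivWithinAt_pi.1
          ((hM t ht).clm_apply (hasDerivWithinAt_const t (Icc 0 T) (Pi.single j (1 : ℝ)))) i
        rw [jacobian_eq_toMatrix' (hX (γ t)).hasFDerivAt, hD, ← LinearMap.toMatrix'_comp]
        simpa [LinearMap.toMatrix'_apply] using h1)
    rwa [trace_jacobian, hdiv, zero_mul] at h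
  have hconst := constant_of_has_deriv_right_zero
    (fun t ht => (hder t ht).continuousWithinAt)
    (fun t ht => (hder t (Ico_subset_Icc_self ht)).mono_of_mem_nhdsWithin
      (Icc_mem_nhdsGE_of_mem ht)) T ⟨hT, le_rfl⟩
  rw [hconst]
  simp [hD, hM0]

theorem divergence_neg (X : (ι → ℝ) → (ι → ℝ)) (y : ι → ℝ) :
    divergence (fun z => -X z) y = -divergence X y := by
  simp only [divergence, pderiv, Pi.neg_apply, ← Finset.sum_neg_distrib]
  refine Finset.sum_congr rfl fun i _ => ?_
  rw [fderiv_fun_neg]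
  rfl

end Liouville

/-! ### The exact flow of a divergence-free field -/

section Flow

variable {E : Type*} [NormedAddCommGroup E] [NormedSpace ℝ E]

theorem _root_.IsIntegralCurveOn.comp_neg {X : E → E} {γ : ℝ → E} {t : ℝ}
    (hγ : IsIntegralCurveOn γ (fun _ => X) (uIcc 0 t)) :
    IsIntegralCurveOn (fun s => γ (-s)) (fun _ x => -X x) (uIcc 0 (-t)) := by
  intro s hs
  have hmaps : MapsTo (fun s : ℝ => -s) (uIcc 0 (-t)) (uIcc 0 t) := by
    intro r hr
    rw [mem_uIcc] at hr ⊢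
    rcases hr with hr | hr
    · right; constructor <;> linarith [hr.1, hr.2]
    · left; constructor <;> linarith [hr.1, hr.2]
  have h := (hγ (-s) (hmaps hs)).scomp s (hasDerivAt_neg s).hasDerivWithinAt hmaps
  exact h.congr_deriv (neg_one_smul ℝ _)

theorem apply_eq_of_isIntegralCurveOn [FiniteDimensional ℝ E] {X : E → E}
    (hX : ContDiff ℝ 1 X) {t : ℝ} {γ η : ℝ → E}
    (hγ : IsIntegralCurveOn γ (fun _ => X) (uIcc 0 t))
    (hη : IsIntegralCurveOn η (fun _ => X) (uIcc 0 t)) (h0 : γ 0 = η 0) : γ t = η t := by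
  rcases le_total 0 t with ht | ht
  · rw [uIcc_of_le ht] at hγ hη
    exact eqOn_Icc_of_isIntegralCurveOn hX hγ hη h0 ⟨ht, le_rfl⟩
  · have ht' : 0 ≤ -t := by linarith
    have hγ' := hγ.comp_neg
    have hη' := hη.comp_neg
    rw [uIcc_of_le ht'] at hγ' hη'
    have := eqOn_Icc_of_isIntegralCurveOn hX.neg hγ' hη' (by simpa using h0) ⟨ht', le_rfl⟩
    simpa using this

/-- By uniqueness, `exactFlow` agrees with every solution, not only with the chosen one. -/
theorem exactFlow_apply [FiniteDimensional ℝ E] {X : E → E} (hX : ContDiff ℝ 1 X) {t : ℝ}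
    {γ : ℝ → E} (hγ : IsIntegralCurveOn γ (fun _ => X) (uIcc 0 t)) :
    γ 0 ∈ flowDomain X t ∧ exactFlow X t (γ 0) = γ t := by
  have hmem : γ 0 ∈ flowDomain X t := ⟨γ, rfl, hγ⟩
  refine ⟨hmem, ?_⟩
  rw [exactFlow, dif_pos hmem]
  exact apply_eq_of_isIntegralCurveOn hX hmem.choose_spec.2 hγ hmem.choose_spec.1

variable {ι : Type*} [Fintype ι] [DecidableEq ι]

/-- For a divergence-free `C¹` field, integral curves up to time `t` persist under perturbation of
the initial value, and the time-`t` map has derivative of determinant one. Negative times reduce to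
positive ones by reversing the sign of the field, which preserves the divergence condition. -/
theorem exists_flow_hasFDerivAt_det_eq_one {X : (ι → ℝ) → (ι → ℝ)} (hX : ContDiff ℝ 1 X)
    (hdiv : ∀ y, divergence X y = 0) {t : ℝ} {γ : ℝ → ι → ℝ}
    (hγ : IsIntegralCurveOn γ (fun _ => X) (uIcc 0 t)) :
    ∃ (φ : (ι → ℝ) → ℝ → ι → ℝ) (L : (ι → ℝ) →L[ℝ] (ι → ℝ)),
      (∀ᶠ x in 𝓝 (γ 0), φ x 0 = x ∧ IsIntegralCurveOn (φ x) (fun _ => X) (uIcc 0 t)) ∧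
      HasFDerivAt (fun x => φ x t) L (γ 0) ∧
      (LinearMap.toMatrix' (L : (ι → ℝ) →ₗ[ℝ] (ι → ℝ))).det = 1 := by
  rcases le_total 0 t with ht | ht
  · rw [uIcc_of_le ht] at hγ ⊢
    obtain ⟨φ, M, hφ, hM0, hM, hd⟩ := exists_flow_hasFDerivAt hX ht hγ
    exact ⟨φ, M t, hφ, hd,
      det_eq_one_of_divergence_eq_zero (hX.differentiable one_ne_zero) hdiv ht hM0 hM⟩
  · have ht' : 0 ≤ -t := by linarith
    have hγ' := hγ.comp_neg
    rw [uIcc_of_le ht'] at hγ'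
    obtain ⟨φ, M, hφ, hM0, hM, hd⟩ := exists_flow_hasFDerivAt hX.neg ht' hγ'
    rw [neg_zero] at hφ hd
    refine ⟨fun x s => φ x (-s), M (-t), ?_, hd,
      det_eq_one_of_divergence_eq_zero (hX.neg.differentiable one_ne_zero)
        (fun y => by rw [divergence_neg, hdiv, neg_zero]) ht' hM0 hM⟩
    filter_upwards [hφ] with x hx
    refine ⟨by simpa using hx.1, ?_⟩
    -- Reversing time twice restores `X` and the interval `uIcc 0 t`.
    have h := hx.2
    rw [← uIcc_of_le ht'] at h
    simpa using h.comp_neg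

/-- The flow of a divergence-free `C¹` field is differentiable on its open domain and preserves
volume. -/
theorem isOpen_flowDomain_and_det_jacobian {X : (ι → ℝ) → (ι → ℝ)} (hX : ContDiff ℝ 1 X)
    (hdiv : ∀ y, divergence X y = 0) (t : ℝ) :
    IsOpen (flowDomain X t) ∧ ∀ y₀ ∈ flowDomain X t,
      DifferentiableAt ℝ (exactFlow X t) y₀ ∧ (jacobian (exactFlow X t) y₀).det = 1 := by
  refine ⟨isOpen_iff_mem_nhds.2 ?_, ?_⟩
  · rintro _ ⟨γ, rfl, hγ⟩
    obtain ⟨φ, L, hφ, -, -⟩ := exists_flow_hasFDerivAt_det_eq_one hX hdiv hγ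
    filter_upwards [hφ] with x hx using ⟨φ x, hx⟩
  · rintro _ ⟨γ, rfl, hγ⟩
    obtain ⟨φ, L, hφ, hL, hdet⟩ := exists_flow_hasFDerivAt_det_eq_one hX hdiv hγ
    have hflow : HasFDerivAt (exactFlow X t) L (γ 0) := by
      refine hL.congr_of_eventuallyEq ?_
      filter_upwards [hφ] with x hx
      have := (exactFlow_apply hX hx.2).2
      rwa [hx.1] at this
    exact ⟨hflow.differentiableAt, by rw [jacobian_eq_toMatrix' hflow, hdet]⟩

end Flow

/-! ### The structure matrix of a charged particle in a magnetic field -/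

section Poisson

variable {ι : Type*} [Fintype ι] [DecidableEq ι]

/-- If the partial derivatives are differentiable, so is the Fréchet derivative, since it is their
combination with the coordinate functionals. -/
theorem differentiable_fderiv_of_differentiable_grad {H : (ι → ℝ) → ℝ}
    (h : ∀ i, Differentiable ℝ (fun y => grad H y i)) : Differentiable ℝ (fderiv ℝ H) := by
  have heq : fderiv ℝ H = fun y => ∑ i, grad H y i •
      (ContinuousLinearMap.proj i : (ι → ℝ) →L[ℝ] ℝ) := by
    ext y v
    conv_lhs => rw [pi_eq_sum_univ' v]
    simp [grad, pderiv, mul_comm]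
  rw [heq]
  exact Differentiable.fun_sum fun i _ => (h i).smul_const _

/-- Symmetry of the second partial derivatives of a twice differentiable function; no continuity of
the second derivative is needed. -/
theorem pderiv_grad_comm {H : (ι → ℝ) → ℝ} (hH : Differentiable ℝ H)
    (h : ∀ i, Differentiable ℝ (fun y => grad H y i)) (i j : ι) (y : ι → ℝ) :
    pderiv i (fun z => grad H z j) y = pderiv j (fun z => grad H z i) y := by
  have hd := (differentiable_fderiv_of_differentiable_grad h y).hasFDerivAt
  have key : ∀ i j : ι, pderiv i (fun z => grad H z j) y =
      fderiv ℝ (fderiv ℝ H) y (Pi.single i 1) (Pi.single j 1) := by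
    intro i j
    have := (hd.clm_apply (hasFDerivAt_const (Pi.single j (1 : ℝ) : ι → ℝ) y)).fderiv
    simp only [pderiv, grad]
    rw [this]
    simp
  rw [key, key]
  exact second_derivative_symmetric (fun y => (hH y).hasFDerivAt) hd _ _

/-- The gyrofrequency `ω(q) = (c / m) b(q)`, as a function on phase space. -/
noncomputable def gyrofrequency (m c : ℝ) (b : (Fin 3 → ℝ) → (Fin 3 → ℝ)) (y : Phase) :
    Fin 3 → ℝ :=
  (c / m) • b (fun i => y (Sum.inl i))

theorem hasFDerivAt_gyrofrequency {m c : ℝ} {b : (Fin 3 → ℝ) → (Fin 3 → ℝ)}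
    (hb : Differentiable ℝ b)
    (k : Fin 3) (y : Phase) :
    HasFDerivAt (fun z => gyrofrequency m c b z k)
      ((c / m) • (fderiv ℝ (fun q => b q k) (fun i => y (Sum.inl i))).comp
        (ContinuousLinearMap.pi fun i => ContinuousLinearMap.proj (Sum.inl i))) y := by
  have h1 : HasFDerivAt (fun q => b q k) (fderiv ℝ (fun q => b q k) (fun i => y (Sum.inl i)))
      (fun i => y (Sum.inl i)) := (differentiable_pi.1 hb k _).hasFDerivAt
  have h2 : HasFDerivAt (fun (z : Phase) i => z (Sum.inl i))
      (ContinuousLinearMap.pi fun i : Fin 3 => ContinuousLinearMap.proj (R := ℝ)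
        (φ := fun _ : Fin 3 ⊕ Fin 3 => ℝ) (Sum.inl i)) y :=
    ContinuousLinearMap.hasFDerivAt (ContinuousLinearMap.pi fun i : Fin 3 =>
      ContinuousLinearMap.proj (R := ℝ) (φ := fun _ : Fin 3 ⊕ Fin 3 => ℝ) (Sum.inl i))
  exact (h1.comp y h2).const_mul (c / m)

theorem pderiv_inl_gyrofrequency {m c : ℝ} {b : (Fin 3 → ℝ) → (Fin 3 → ℝ)}
    (hb : Differentiable ℝ b)
    (l k : Fin 3) (y : Phase) :
    pderiv (Sum.inl l) (fun z => gyrofrequency m c b z k) y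
      = c / m * pderiv l (fun q => b q k) (fun i => y (Sum.inl i)) := by
  rw [pderiv, (hasFDerivAt_gyrofrequency hb k y).fderiv, pderiv]
  simp only [smul_apply, ContinuousLinearMap.comp_apply, smul_eq_mul]
  congr 2
  ext i
  simp [Pi.single_apply]

theorem pderiv_inr_gyrofrequency {m c : ℝ} {b : (Fin 3 → ℝ) → (Fin 3 → ℝ)}
    (hb : Differentiable ℝ b)
    (l k : Fin 3) (y : Phase) : pderiv (Sum.inr l) (fun z => gyrofrequency m c b z k) y = 0 := by
  rw [pderiv, (hasFDerivAt_gyrofrequency hb k y).fderiv]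
  simp only [smul_apply, ContinuousLinearMap.comp_apply, smul_eq_mul]
  have : (ContinuousLinearMap.pi fun i : Fin 3 => ContinuousLinearMap.proj (R := ℝ)
        (φ := fun _ : Fin 3 ⊕ Fin 3 => ℝ) (Sum.inl i)) (Pi.single (Sum.inr l) 1) = 0 := by
    ext i
    simp
  rw [this, map_zero, mul_zero]

theorem structureMatrix_eq (m c : ℝ) (b : (Fin 3 → ℝ) → (Fin 3 → ℝ)) (y : Phase) :
    structureMatrix m c b y =
      Matrix.fromBlocks 0 1 (-1) (m • crossMatrix (gyrofrequency m c b y)) := rfl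

/-- `crossMatrix` is linear in `ω`, so it commutes with partial derivatives. -/
theorem differentiableAt_and_pderiv_crossMatrix {ω : Phase → Fin 3 → ℝ} {y : Phase}
    (hω : ∀ k, DifferentiableAt ℝ (fun z => ω z k) y) (m : ℝ) (i j : Fin 3) :
    DifferentiableAt ℝ (fun z => (m • crossMatrix (ω z)) i j) y ∧ ∀ l,
      pderiv l (fun z => (m • crossMatrix (ω z)) i j) y =
        (m • crossMatrix (fun k => pderiv l (fun z => ω z k) y)) i j := by
  have hz : DifferentiableAt ℝ (fun _ : Phase => m * (0 : ℝ)) y := differentiableAt_const _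
  have hp := fun k => (hω k).const_mul m
  have hn := fun k => (hω k).fun_neg.const_mul m
  have ez : ∀ l, pderiv l (fun _ : Phase => m * (0 : ℝ)) y = m * 0 := fun l => by
    simp [pderiv]
  have ep : ∀ k l, pderiv l (fun z => m * ω z k) y = m * pderiv l (fun z => ω z k) y :=
    fun k l => by
      simp only [pderiv]
      rw [fderiv_const_mul (hω k)]
      rfl
  have en : ∀ k l, pderiv l (fun z => m * -ω z k) y = m * -pderiv l (fun z => ω z k) y :=
    fun k l => by
      simp only [pderiv]
      rw [fderiv_const_mul (hω k).fun_neg, fderiv_fun_neg]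
      rfl
  fin_cases i <;> fin_cases j <;>
    first
    | exact ⟨hz, ez⟩
    | exact ⟨hp _, ep _⟩
    | exact ⟨hn _, en _⟩

theorem differentiableAt_and_pderiv_structureMatrix {m c : ℝ} {b : (Fin 3 → ℝ) → (Fin 3 → ℝ)}
    (hb : Differentiable ℝ b)
    (y : Phase) (i j : Fin 3 ⊕ Fin 3) :
    DifferentiableAt ℝ (fun z => structureMatrix m c b z i j) y ∧ ∀ l,
      pderiv l (fun z => structureMatrix m c b z i j) y =
        Matrix.fromBlocks 0 0 0
          (m • crossMatrix (fun k => pderiv l (fun z => gyrofrequency m c b z k) y)) i j := by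
  rcases i with i | i <;> rcases j with j | j
  · exact ⟨differentiableAt_const _, fun l => by simp [structureMatrix_eq, pderiv]⟩
  · exact ⟨differentiableAt_const _, fun l => by simp [structureMatrix_eq, pderiv]⟩
  · exact ⟨differentiableAt_const _, fun l => by simp [structureMatrix_eq, pderiv]⟩
  · exact differentiableAt_and_pderiv_crossMatrix
      (fun k => (hasFDerivAt_gyrofrequency hb k y).differentiableAt) m i j

theorem crossMatrix_transpose (ω : Fin 3 → ℝ) : (crossMatrix ω).transpose = -crossMatrix ω := by
  ext i j
  fin_cases i <;> fin_cases j <;> simp [crossMatrix]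

theorem crossMatrix_zero : crossMatrix (fun _ => 0) = 0 := by
  ext i j
  fin_cases i <;> fin_cases j <;> simp [crossMatrix]

/-- Only the lower right block of `B` varies, and only with `q`. Hence the Jacobi identity is
trivial unless all three indices are momenta, and for three distinct momenta it is `∇ · b = 0` up to a
factor; otherwise the terms cancel by skew-symmetry. -/
theorem isPoissonTensor_structureMatrix {m c : ℝ} {b : (Fin 3 → ℝ) → (Fin 3 → ℝ)}
    (hb : Differentiable ℝ b) (hdiv : ∀ q, divergence b q = 0) :
    IsPoissonTensor (structureMatrix m c b) where
  differentiable i j y := (differentiableAt_and_pderiv_structureMatrix hb y i j).1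
  skew y := by
    rw [structureMatrix_eq, Matrix.fromBlocks_transpose, Matrix.fromBlocks_neg,
      Matrix.transpose_smul, crossMatrix_transpose]
    simp
  jacobi y i j k := by
    have hd := hdiv (fun i => y (Sum.inl i))
    simp only [divergence, Fin.sum_univ_three] at hd
    simp only [fun i j =>
      (differentiableAt_and_pderiv_structureMatrix (m := m) (c := c) hb y i j).2]
    simp only [structureMatrix_eq, Fintype.sum_sum_type,
      pderiv_inl_gyrofrequency hb, pderiv_inr_gyrofrequency hb]
    rcases i with i | i <;> rcases j with j | j <;> rcases k with k | k <;>
      simp only [Matrix.fromBlocks_apply₁₁, Matrix.fromBlocks_apply₁₂, Matrix.fromBlocks_apply₂₁,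
        Matrix.fromBlocks_apply₂₂, crossMatrix_zero, smul_zero, Matrix.zero_apply, zero_mul,
        mul_zero, add_zero, Finset.sum_const_zero]
    simp only [Matrix.one_apply, mul_ite, mul_one, mul_zero, Finset.sum_add_distrib,
      Finset.sum_ite_eq', Finset.mem_univ, if_true, Matrix.smul_apply, smul_eq_mul]
    fin_cases i <;> fin_cases j <;> fin_cases k <;> simp [crossMatrix] <;>
      first
      | linear_combination (m * (c / m)) * hd
      | linear_combination (-(m * (c / m))) * hd

/-- In `∑ ∂ᵢ X_i` the terms from the constant blocks cancel by the symmetry of the Hessian of `H`,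
and the contribution of `m Ω` vanishes because it pairs the skew matrix `Ω`, which does not depend on
`p`, with the symmetric Hessian in `p`. -/
theorem divergence_vectorField_eq_zero {m c : ℝ} {b : (Fin 3 → ℝ) → (Fin 3 → ℝ)}
    (hb : Differentiable ℝ b) {H : Phase → ℝ} (hH : Differentiable ℝ H)
    (hX : Differentiable ℝ (vectorField (structureMatrix m c b) H)) (y : Phase) :
    divergence (vectorField (structureMatrix m c b) H) y = 0 := by
  set X := vectorField (structureMatrix m c b) H with hXdef
  have hinl : ∀ i z, X z (Sum.inl i) = grad H z (Sum.inr i) := by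
    intro i z
    simp [hXdef, vectorField, structureMatrix_eq, Matrix.mulVec, dotProduct, Matrix.one_apply]
  have hinr : ∀ i z, X z (Sum.inr i) = -grad H z (Sum.inl i) +
      ∑ j, (m • crossMatrix (gyrofrequency m c b z)) i j * grad H z (Sum.inr j) := by
    intro i z
    simp [hXdef, vectorField, structureMatrix_eq, Matrix.mulVec, dotProduct, Matrix.one_apply]
  have hp : ∀ i, Differentiable ℝ (fun z => grad H z (Sum.inr i)) := fun i => by
    simpa only [hinl] using differentiable_pi.1 hX (Sum.inl i)
  have hΩ : ∀ i j, Differentiable ℝ (fun z => (m • crossMatrix (gyrofrequency m c b z)) i j) :=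
    fun i j z => (differentiableAt_and_pderiv_structureMatrix (m := m) (c := c) hb z
      (Sum.inr i) (Sum.inr j)).1
  have hs : ∀ i, Differentiable ℝ
      (fun z => ∑ j, (m • crossMatrix (gyrofrequency m c b z)) i j * grad H z (Sum.inr j)) :=
    fun i => Differentiable.fun_sum fun j _ => (hΩ i j).mul (hp j)
  -- `∂H/∂q` is recovered from the differentiable field `X` and from `∂H/∂p`, which is part of `X`;
  -- so `H` is twice differentiable although only `X` is assumed to be smooth.
  have hq : ∀ i, Differentiable ℝ (fun z => grad H z (Sum.inl i)) := fun i => by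
    have heq : (fun z => grad H z (Sum.inl i)) = fun z =>
        (∑ j, (m • crossMatrix (gyrofrequency m c b z)) i j * grad H z (Sum.inr j)) -
          X z (Sum.inr i) := by
      ext z
      rw [hinr]
      ring
    rw [heq]
    exact (hs i).sub (differentiable_pi.1 hX (Sum.inr i))
  have hg : ∀ i, Differentiable ℝ (fun z => grad H z i) := Sum.rec hq hp
  have hterm : ∀ i j, pderiv (Sum.inr i)
      (fun z => (m • crossMatrix (gyrofrequency m c b z)) i j * grad H z (Sum.inr j)) y =
      (m • crossMatrix (gyrofrequency m c b y)) i j *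
        pderiv (Sum.inr i) (fun z => grad H z (Sum.inr j)) y := by
    intro i j
    have h0 : pderiv (Sum.inr i) (fun z => (m • crossMatrix (gyrofrequency m c b z)) i j) y =
        0 := by
      have := (differentiableAt_and_pderiv_structureMatrix (m := m) (c := c) hb y
        (Sum.inr i) (Sum.inr j)).2 (Sum.inr i)
      simp only [structureMatrix_eq, Matrix.fromBlocks_apply₂₂, pderiv_inr_gyrofrequency hb] at this
      rw [this, crossMatrix_zero, smul_zero, Matrix.zero_apply]
    simp only [pderiv] at h0 ⊢
    rw [fderiv_fun_mul (hΩ i j y) (hp j y), add_apply, smul_apply, smul_apply, h0, smul_zero,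
      add_zero, smul_eq_mul]
  have hinrd : ∀ i, pderiv (Sum.inr i) (fun z => X z (Sum.inr i)) y =
      -pderiv (Sum.inr i) (fun z => grad H z (Sum.inl i)) y +
        ∑ j, (m • crossMatrix (gyrofrequency m c b y)) i j *
          pderiv (Sum.inr i) (fun z => grad H z (Sum.inr j)) y := by
    intro i
    simp only [← hterm, hinr]
    simp only [pderiv]
    rw [fderiv_fun_add (hq i y).fun_neg (hs i y), fderiv_fun_neg,
      fderiv_fun_sum fun j _ => ((hΩ i j).fun_mul (hp j)) y]
    simp
  have hsymm := fun i j => pderiv_grad_comm hH hg i j y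
  simp only [divergence, Fintype.sum_sum_type, hinl, hinrd]
  rw [Finset.sum_add_distrib, Finset.sum_neg_distrib]
  simp only [hsymm (Sum.inl _) (Sum.inr _), add_neg_cancel_left]
  simp only [Fin.sum_univ_three, crossMatrix]
  simp
  rw [hsymm (Sum.inr 1) (Sum.inr 0), hsymm (Sum.inr 2) (Sum.inr 0), hsymm (Sum.inr 2) (Sum.inr 1)]
  ring

end Poisson

end PoissonFlow

theorem mainTheorem5 (m c : ℝ) (hm : 0 < m)
    (b : (Fin 3 → ℝ) → (Fin 3 → ℝ)) (hb : Differentiable ℝ b)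
    (hdiv : ∀ q, PoissonFlow.divergence b q = 0)
    (B : PoissonFlow.Phase → Matrix (Fin 3 ⊕ Fin 3) (Fin 3 ⊕ Fin 3) ℝ)
    (hB : B = PoissonFlow.structureMatrix m c b)
    (H : PoissonFlow.Phase → ℝ) (hH : Differentiable ℝ H)
    (X : PoissonFlow.Phase → PoissonFlow.Phase)
    (hX : X = PoissonFlow.vectorField B H) (hXsmooth : ContDiff ℝ 1 X) :
    -- the system is a Poisson system
    PoissonFlow.IsPoissonTensor B ∧
    -- the exact flow is well defined: it sends `y(0)` to `y(t)` for every solution `y`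
    (∀ (t : ℝ) (y : ℝ → PoissonFlow.Phase),
      IsIntegralCurveOn y (fun _ => X) (Set.uIcc 0 t) →
        y 0 ∈ PoissonFlow.flowDomain X t ∧ PoissonFlow.exactFlow X t (y 0) = y t) ∧
    -- it is differentiable on its open domain, with Jacobian determinant one
    ∀ t : ℝ, IsOpen (PoissonFlow.flowDomain X t) ∧
      ∀ y₀ ∈ PoissonFlow.flowDomain X t,
        DifferentiableAt ℝ (PoissonFlow.exactFlow X t) y₀ ∧
        (PoissonFlow.jacobian (PoissonFlow.exactFlow X t) y₀).det = 1 := by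
  subst hB hX
  exact ⟨PoissonFlow.isPoissonTensor_structureMatrix hb hdiv,
    fun t y hy => PoissonFlow.exactFlow_apply hXsmooth hy,
    PoissonFlow.isOpen_flowDomain_and_det_jacobian hXsmooth
      (PoissonFlow.divergence_vectorField_eq_zero hb hH (hXsmooth.differentiable one_ne_zero))⟩
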